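/- Let $G$ be a finite simple graph with totally ordered vertex set $I=\{\alpha_1,\dots,\alpha_n\}$. Call two vertices concurrent if they are equal or adjacent in $G$. A heap over $G$ is a finite set $E\subset I\times\{0,1,2,\dots\}$ of pieces $(\alpha,i)$ (position $\alpha$, level $i$) such that distinct pieces in concurrent positions have different levels, and for every $(\alpha,i)\in E$ with $i>0$ there is $(\beta,i-1)\in E$ with $\beta$ concurrent to $\alpha$. The weight of $E$ is the vector in $\mathbb{Z}_{\ge 0}^n$ counting the pieces of $E$ in each position. The superposition $E\circ F$ is obtained by letting the pieces of $F$ fall onto $E$, lowest level first, each coming to rest one level above the highest piece present in a concurrent position (at level $0$ if there is none); the empty heap is the neutral element. Pieces of $E$ are partially ordered by the reflexive and transitive closure of the relation "in concurrent positions and on a lower level", and $E$ is a pyramid with basis $\alpha$ if it has exactly one minimal piece and this piece is in position $\alpha$. The standard word $\operatorname{st}(E)$ is the lexicographically greatest word $p_1\cdots p_m$ over $I$ with $p_1\circ\cdots\circ p_m=E$, and $E\le F$ means $\operatorname{st}(E)\le\operatorname{st}(F)$ lexicographically. A heap $E$ is primitive if $E=U\circ V=V\circ U$ implies that $U$ or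 $V$ is empty. Conjugacy is the transitive closure of the relation $U\circ V\sim V\circ U$. A Lyndon heap is a non-empty primitive heap which is minimal in its conjugacy class. For $\mathbf{k}\in\mathbb{Z}_{\ge 0}^n$ let $\mathcal{P}^j_{\mathbf{k}}$ be the set of pyramids of weight $\mathbf{k}$ with basis $\alpha_j$ and $\mathcal{LH}_{\mathbf{k}}$ the set of Lyndon heaps of weight $\mathbf{k}$. Then these sets are finite, and for every $\mathbf{k}=(\mathbf{k}(1),\dots,\mathbf{k}(n))\in\mathbb{Z}_{\ge 0}^n$ and every $1\le j\le n$, $$|\mathcal{P}^j_{\mathbf{k}}|=\sum_{l\mid\mathbf{k}}\frac{\mathbf{k}(j)}{l}\,|\mathcal{LH}_{\mathbf{k}/l}|,$$ where $l$ runs over the positive integers dividing every entry of $\mathbf{k}$ (for $\mathbf{k}=0$ both sides are $0$). -/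

import Mathlib

/-- The concurrency relation of `G`: two positions are concurrent when they are equal or adjacent.
Distinct positions commute exactly when they are not concurrent. -/
def Concurrent {I : Type*} (G : SimpleGraph I) (a b : I) : Prop :=
  a = b ∨ G.Adj a b

/-- A heap of pieces over `G`. A basic piece `(a, i)` has position `a` and level `i`; distinct
pieces in concurrent positions lie on different levels (pre-heap), and every piece of positive
level rests on a piece one level below in a concurrent position. -/
@[ext]
structure PieceHeap {I : Type*} (G : SimpleGraph I) where
  pieces : Finset (I × ℕ)
  preheap : ∀ p ∈ pieces, ∀ q ∈ pieces, p ≠ q → Concurrent G p.1 q.1 → p.2 ≠ q.2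
  supported : ∀ a i, (a, i + 1) ∈ pieces → ∃ b, (b, i) ∈ pieces ∧ Concurrent G a b

namespace PieceHeap

section

variable {I : Type*} {G : SimpleGraph I}

/-- The empty heap. -/
def empty : PieceHeap G where
  pieces := ∅
  preheap := by simp
  supported := by simp

/-- The heap with a single piece in position `a`. -/
def single (a : I) : PieceHeap G where
  pieces := {(a, 0)}
  preheap := by
    intro p hp q hq hne
    simp only [Finset.mem_singleton] at hp hq
    exact absurd (hp.trans hq.symm) hne
  supported := by
    intro b i h
    simp at h

open Classical in
/-- The level at which a piece dropped in position `a` onto `E` comes to rest: one more than the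
highest level of a piece of `E` in a position concurrent to `a`, and `0` if there is none. -/
noncomputable def restLevel (E : PieceHeap G) (a : I) : ℕ :=
  (E.pieces.filter (fun p => Concurrent G a p.1)).sup (fun p => p.2 + 1)

theorem lt_restLevel (E : PieceHeap G) {a : I} {p : I × ℕ} (hp : p ∈ E.pieces)
    (h : Concurrent G a p.1) : p.2 < E.restLevel a := by
  classical
  exact Finset.le_sup (f := fun p : I × ℕ => p.2 + 1) (Finset.mem_filter.2 ⟨hp, h⟩)

theorem exists_of_restLevel_eq_succ (E : PieceHeap G) {a : I} {i : ℕ}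
    (h : E.restLevel a = i + 1) : ∃ b, (b, i) ∈ E.pieces ∧ Concurrent G a b := by
  classical
  have hne : (E.pieces.filter (fun p => Concurrent G a p.1)).Nonempty := by
    rw [Finset.nonempty_iff_ne_empty]
    intro h0
    simp [restLevel, h0] at h
  obtain ⟨p, hp, hpe⟩ := Finset.exists_mem_eq_sup _ hne (fun p : I × ℕ => p.2 + 1)
  obtain ⟨hpE, hpc⟩ := Finset.mem_filter.1 hp
  have hlev : p.2 = i := by
    have h1 : E.restLevel a = p.2 + 1 := hpe
    omega
  exact ⟨p.1, by rw [← hlev]; exact hpE, hpc⟩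

end

variable {I : Type*} [LinearOrder I] {G : SimpleGraph I}

/-- The heap obtained from `E` by letting one piece fall in position `a`. -/
noncomputable def drop (E : PieceHeap G) (a : I) : PieceHeap G where
  pieces := insert (a, E.restLevel a) E.pieces
  preheap := by
    intro p hp q hq hne hc
    rcases Finset.mem_insert.1 hp with rfl | hp' <;> rcases Finset.mem_insert.1 hq with rfl | hq'
    · exact absurd rfl hne
    · exact (E.lt_restLevel hq' hc).ne'
    · exact (E.lt_restLevel hp' (hc.imp Eq.symm (fun h => h.symm))).ne
    · exact E.preheap p hp' q hq' hne hc
  supported := by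
    intro b i h
    rcases Finset.mem_insert.1 h with h' | h'
    · obtain ⟨rfl, h2⟩ := Prod.mk.inj h'
      obtain ⟨c, hc, hbc⟩ := E.exists_of_restLevel_eq_succ h2.symm
      exact ⟨c, Finset.mem_insert_of_mem hc, hbc⟩
    · obtain ⟨c, hc, hbc⟩ := E.supported b i h'
      exact ⟨c, Finset.mem_insert_of_mem hc, hbc⟩

/-- The positions of the pieces of `F`, listed level by level from the bottom (and by increasing
position within a level). -/
def levelWord (F : PieceHeap G) : List I :=
  ((F.pieces.image (fun p => toLex (p.2, p.1))).sort (· ≤ ·)).map (fun q => (ofLex q).2)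

/-- The superposition `E ∘ F` of `F` over `E`: the pieces of `F` fall, lowest level first, onto
`E`. Pieces of the same level commute, so their relative order is irrelevant. -/
noncomputable def superpose (E F : PieceHeap G) : PieceHeap G :=
  F.levelWord.foldl drop E

/-- The heap `p₁ ∘ p₂ ∘ ⋯ ∘ pₘ` of the word `p₁ p₂ ⋯ pₘ`. -/
noncomputable def ofWord (G : SimpleGraph I) (w : List I) : PieceHeap G :=
  w.foldl (fun E a => superpose E (single a)) empty

/-- The weight of a heap: the number of its pieces in each position. -/
def weight (E : PieceHeap G) (a : I) : ℕ :=
  (E.pieces.filter (fun p => p.1 = a)).card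

/-- The partial order on the pieces of `E`: the reflexive and transitive closure of
"in concurrent positions and on a lower level". -/
def pieceLE (E : PieceHeap G) : I × ℕ → I × ℕ → Prop :=
  Relation.ReflTransGen
    (fun p q => p ∈ E.pieces ∧ q ∈ E.pieces ∧ Concurrent G p.1 q.1 ∧ p.2 < q.2)

/-- The minimal pieces of `E`. -/
def minPieces (E : PieceHeap G) : Set (I × ℕ) :=
  {p | p ∈ E.pieces ∧ ∀ q ∈ E.pieces, E.pieceLE q p → q = p}

/-- `E` is a pyramid with basis `a`: it has exactly one minimal piece, and this piece has
position `a`. -/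
def IsPyramid (E : PieceHeap G) (a : I) : Prop :=
  ∃ i : ℕ, E.minPieces = {(a, i)}

/-- `w` is the standard word of `E`: the lexicographically greatest word whose heap is `E`. -/
def IsStandardWord (E : PieceHeap G) (w : List I) : Prop :=
  IsGreatest {v : List I | ofWord G v = E} w

/-- The total order on heaps: lexicographic comparison of standard words. -/
def heapLE (E F : PieceHeap G) : Prop :=
  ∃ u v : List I, E.IsStandardWord u ∧ F.IsStandardWord v ∧ u ≤ v

/-- `F` is a transpose of `E`. -/
def IsTranspose (E F : PieceHeap G) : Prop :=
  ∃ U V : PieceHeap G, E = superpose U V ∧ F = superpose V U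

/-- Conjugacy of heaps: the transitive closure of transposition. -/
def Conjugate : PieceHeap G → PieceHeap G → Prop :=
  Relation.TransGen IsTranspose

/-- `E` is primitive: `E = U ∘ V = V ∘ U` only if `U` or `V` is empty. -/
def IsPrimitive (E : PieceHeap G) : Prop :=
  ∀ U V : PieceHeap G, E = superpose U V → E = superpose V U → U = empty ∨ V = empty

/-- `E` is a Lyndon heap: nonempty, primitive and minimal in its conjugacy class. -/
def IsLyndon (E : PieceHeap G) : Prop :=
  E ≠ empty ∧ E.IsPrimitive ∧ ∀ F, Conjugate E F → heapLE E F

/-- The set of pyramids of weight `k` with basis `j`. -/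
def pyramids (G : SimpleGraph I) (k : I → ℕ) (j : I) : Set (PieceHeap G) :=
  {E | E.IsPyramid j ∧ E.weight = k}

/-- The set of Lyndon heaps of weight `m`. -/
def lyndonHeaps (G : SimpleGraph I) (m : I → ℕ) : Set (PieceHeap G) :=
  {E | E.IsLyndon ∧ E.weight = m}

end PieceHeap

/-- The positive integers `l` dividing every entry of the weight `k` (the empty set for `k = 0`). -/
def weightDivisors {I : Type*} [Fintype I] (k : I → ℕ) : Finset ℕ :=
  (Finset.univ.gcd k).divisors

theorem mem_weightDivisors {I : Type*} [Fintype I] {k : I → ℕ} (hk : k ≠ 0) (l : ℕ) :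
    l ∈ weightDivisors k ↔ 0 < l ∧ ∀ i, l ∣ k i := by
  have hg : Finset.univ.gcd k ≠ 0 := by
    intro h
    exact hk (funext fun i => Finset.gcd_eq_zero_iff.1 h i (Finset.mem_univ i))
  rw [weightDivisors, Nat.mem_divisors, Finset.dvd_gcd_iff]
  constructor
  · rintro ⟨h, -⟩
    refine ⟨Nat.pos_of_ne_zero ?_, fun i => h i (Finset.mem_univ i)⟩
    rintro rfl
    exact hk (funext fun i => Nat.eq_zero_of_zero_dvd (h i (Finset.mem_univ i)))
  · rintro ⟨-, h⟩
    exact ⟨fun i _ => h i, hg⟩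

namespace PieceHeap

/-! ### Concurrency and resting levels -/

section Concurrent

variable {I : Type*} {G : SimpleGraph I}

/-! Heaps form a cancellative monoid under superposition, because a heap is determined by its
projections to pairs of concurrent positions (`ext_proj`) and superposition concatenates these
projections. Levels then enter only through the possible first letters of a heap: these are its
pieces on level 0 (`front_iff_level_zero`), and a first letter of `E * F` comes from `E` or commutes
past all of `E` (`front_mul`).

Fix a basis `j`. The heaps whose only possible first letter is `j` form a free monoid on the blocks,
the pyramids with a single piece in position `j` (`exists_block_mul`, `block_mul_unique`). A pyramid
of weight `k` is thus a word of `k j` blocks, encoded by its periodic extension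
(`bijOn_periodicSeqs`), and conjugate pyramids are rotations of each other: a conjugating heap can
be stripped of a factor independent of the pyramid (`exists_strip`), and what is left is a prefix of
the block sequence (`eq_shift_of_mul_eq`).

Sequences whose minimal period is exactly `m j` have primitive heaps, and so is everything conjugate
to them (`isPrimitive_of_conjugate`). Conversely every primitive heap with a piece in position `j`
is conjugate to such a pyramid (`exists_primitiveSeq`). Hence each Lyndon heap of weight `m`
accounts for one shift orbit of size `m j` (`ncard_primitiveSeqs`). Sorting the sequences of period
`k j` by their minimal period `k j / l` (`periodicSeqs_eq`) gives the sum over `l`. -/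

theorem concurrent_refl (G : SimpleGraph I) (a : I) : Concurrent G a a := Or.inl rfl

theorem concurrent_symm {a b : I} (h : Concurrent G a b) : Concurrent G b a :=
  h.imp Eq.symm fun h => h.symm

theorem restLevel_eq {E : PieceHeap G} {a : I} {i : ℕ}
    (h : ∀ p ∈ E.pieces, Concurrent G a p.1 → p.2 < i)
    (h' : ∀ i', i = i' + 1 → ∃ b, (b, i') ∈ E.pieces ∧ Concurrent G a b) :
    E.restLevel a = i := by
  classical
  apply le_antisymm
  · refine Finset.sup_le fun p hp => ?_
    rw [Finset.mem_filter] at hp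
    exact h p hp.1 hp.2
  · cases i with
    | zero => exact Nat.zero_le _
    | succ i' =>
      obtain ⟨b, hb, hc⟩ := h' i' rfl
      exact E.lt_restLevel hb hc

end Concurrent

/-! ### Rebuilding a heap from its level word -/

section Words

variable {I : Type*} [LinearOrder I] {G : SimpleGraph I}

/-- The pieces of a heap, sorted by level and then by position. -/
def levelList (F : PieceHeap G) : List (ℕ ×ₗ I) :=
  (F.pieces.image (fun p => toLex (p.2, p.1))).sort (· ≤ ·)

theorem levelWord_eq_map (F : PieceHeap G) :
    F.levelWord = F.levelList.map (fun q => (ofLex q).2) := rfl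

theorem mem_levelList {F : PieceHeap G} {q : ℕ ×ₗ I} :
    q ∈ F.levelList ↔ ((ofLex q).2, (ofLex q).1) ∈ F.pieces := by
  simp only [levelList, Finset.mem_sort, Finset.mem_image, Prod.exists]
  constructor
  · rintro ⟨a, i, h, rfl⟩
    exact h
  · intro h
    exact ⟨_, _, h, rfl⟩

theorem sortedLT_levelList (F : PieceHeap G) : F.levelList.Pairwise (· < ·) :=
  (Finset.sortedLT_sort _).pairwise

theorem mem_drop {E : PieceHeap G} {a : I} {p : I × ℕ} :
    p ∈ (E.drop a).pieces ↔ p = (a, E.restLevel a) ∨ p ∈ E.pieces :=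
  Finset.mem_insert

/-- Dropped in level order, each piece returns to its own level: the earlier concurrent pieces lie
strictly lower, and the piece supporting it has already been dropped. Prefixes make the induction
possible. -/
theorem mem_foldl_drop_of_prefix (F : PieceHeap G) (l : List (ℕ ×ₗ I)) :
    ∀ r, F.levelList = l ++ r → ∀ q : ℕ ×ₗ I,
      ((ofLex q).2, (ofLex q).1) ∈
        ((l.map (fun q => (ofLex q).2)).foldl drop (empty : PieceHeap G)).pieces ↔ q ∈ l := by
  induction l using List.reverseRecOn with
  | nil => intro r _ q; simp [empty]
  | append_singleton l x ih =>
    intro r hr q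
    have hr' : F.levelList = l ++ (x :: r) := by rw [hr]; simp
    have ih := ih _ hr'
    have hs := F.sortedLT_levelList
    rw [hr', List.pairwise_append, List.pairwise_cons] at hs
    obtain ⟨-, ⟨hxr, -⟩, hlx⟩ := hs
    have hxF : x ∈ F.levelList := by rw [hr']; simp
    set E := (l.map (fun q => (ofLex q).2)).foldl drop (empty : PieceHeap G) with hE
    have hlev : E.restLevel (ofLex x).2 = (ofLex x).1 := by
      apply restLevel_eq
      · rintro ⟨b, i⟩ hp hc
        have hb : toLex (i, b) ∈ l := (ih (toLex (i, b))).1 hp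
        have hlt : toLex (i, b) < x := hlx _ hb x (by simp)
        have hbF : toLex (i, b) ∈ F.levelList := by rw [hr']; simp [hb]
        have hne := F.preheap _ (mem_levelList.1 hxF) _ (mem_levelList.1 hbF)
          (by
            intro h
            apply hlt.ne
            have h1 := congrArg Prod.fst h
            have h2 := congrArg Prod.snd h
            apply ofLex.injective
            exact Prod.ext h2.symm h1.symm) hc
        rw [Prod.Lex.lt_iff] at hlt
        rcases hlt with h | h
        · exact h
        · exact absurd h.1.symm hne
      · intro i' hi
        have hxF' := mem_levelList.1 hxF
        rw [hi] at hxF'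
        obtain ⟨b, hb, hc⟩ := F.supported _ _ hxF'
        refine ⟨b, (ih (toLex (i', b))).2 ?_, hc⟩
        have hbF : toLex (i', b) ∈ F.levelList := mem_levelList.2 hb
        have hlt : toLex (i', b) < x := by
          rw [Prod.Lex.lt_iff]
          left
          show i' < (ofLex x).1
          omega
        rw [hr', List.mem_append, List.mem_cons] at hbF
        rcases hbF with h | h | h
        · exact h
        · exact absurd h hlt.ne
        · exact absurd (hxr _ h) hlt.asymm
    rw [List.map_append, List.foldl_append, List.map_singleton, List.foldl_cons, List.foldl_nil,
      mem_drop, hlev, ih, List.mem_append, List.mem_singleton]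
    constructor
    · rintro (h | h)
      · right
        apply ofLex.injective
        exact Prod.ext (congrArg Prod.snd h) (congrArg Prod.fst h)
      · exact Or.inl h
    · rintro (h | rfl)
      · exact Or.inr h
      · exact Or.inl rfl

theorem foldl_drop_levelWord (F : PieceHeap G) : F.levelWord.foldl drop empty = F := by
  apply PieceHeap.ext
  ext ⟨a, i⟩
  have h := mem_foldl_drop_of_prefix F F.levelList [] (by simp) (toLex (i, a))
  rw [mem_levelList] at h
  exact h

/-! ### Projections to concurrent positions -/

theorem filter_levelList_drop (E : PieceHeap G) (c : I) (p : I → Bool)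
    (hp : p c = true → ∀ a, p a = true → Concurrent G c a) :
    (E.drop c).levelList.filter (fun q => p (ofLex q).2) =
      E.levelList.filter (fun q => p (ofLex q).2) ++
        [toLex (E.restLevel c, c)].filter (fun q => p (ofLex q).2) := by
  have hs : (E.levelList.filter (fun q => p (ofLex q).2) ++
        [toLex (E.restLevel c, c)].filter (fun q => p (ofLex q).2)).Pairwise (· < ·) := by
    rw [List.pairwise_append]
    refine ⟨E.sortedLT_levelList.filter _, (List.pairwise_singleton _ _).filter _, ?_⟩
    intro x hx y hy
    rw [List.mem_filter] at hx hy
    obtain ⟨hy, hy'⟩ := hy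
    rw [List.mem_singleton] at hy
    subst hy
    rw [Prod.Lex.lt_iff]
    left
    exact E.lt_restLevel (mem_levelList.1 hx.1) (hp hy' _ hx.2)
  refine List.Perm.eq_of_pairwise (fun a b _ _ h h' => absurd h h'.asymm)
    ((E.drop c).sortedLT_levelList.filter _) hs ?_
  rw [List.perm_ext_iff_of_nodup
    (((E.drop c).sortedLT_levelList.filter _).imp fun h => h.ne) (hs.imp fun h => h.ne)]
  intro q
  simp only [List.mem_append, List.mem_filter, mem_levelList, mem_drop, List.mem_singleton,
    Prod.mk.injEq]
  have : q = toLex (E.restLevel c, c) ↔ (ofLex q).2 = c ∧ (ofLex q).1 = E.restLevel c := by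
    constructor
    · rintro rfl
      exact ⟨rfl, rfl⟩
    · rintro ⟨h1, h2⟩
      apply ofLex.injective
      exact Prod.ext h2 h1
  rw [this]
  tauto

/-- The word of the pieces of `E` in positions `a` and `b`, from the bottom to the top. -/
def proj (E : PieceHeap G) (a b : I) : List I :=
  E.levelWord.filter (fun c => c = a ∨ c = b)

theorem proj_drop (E : PieceHeap G) (c : I) {a b : I} (h : Concurrent G a b) :
    (E.drop c).proj a b = E.proj a b ++ [c].filter (fun c => c = a ∨ c = b) := by
  have h1 := filter_levelList_drop E c (fun c => c = a ∨ c = b) (by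
    simp only [decide_eq_true_eq]
    rintro (rfl | rfl) d (rfl | rfl)
    · exact concurrent_refl _ _
    · exact h
    · exact (concurrent_symm h)
    · exact concurrent_refl _ _)
  have h2 := congrArg (List.map (fun q : ℕ ×ₗ I => (ofLex q).2)) h1
  rw [List.map_append] at h2
  simp only [proj, levelWord_eq_map, List.filter_map]
  refine h2.trans ?_
  congr 1
  by_cases hc : c = a ∨ c = b
  · rw [List.filter_cons_of_pos (by exact decide_eq_true hc),
      List.filter_cons_of_pos (by exact decide_eq_true hc)]
    rfl
  · rw [List.filter_cons_of_neg (by exact fun h => hc (of_decide_eq_true h)),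
      List.filter_cons_of_neg (by exact fun h => hc (of_decide_eq_true h))]
    rfl

theorem proj_foldl_drop (w : List I) {a b : I} (h : Concurrent G a b) :
    ∀ E : PieceHeap G, (w.foldl drop E).proj a b =
      E.proj a b ++ w.filter (fun c => c = a ∨ c = b) := by
  induction w with
  | nil => intro E; simp
  | cons c w ih =>
    intro E
    rw [List.foldl_cons, ih, proj_drop E c h, List.append_assoc, ← List.filter_append,
      List.singleton_append]

theorem drop_comm (E : PieceHeap G) {a b : I} (h : ¬ Concurrent G a b) :
    (E.drop a).drop b = (E.drop b).drop a := by
  have key : ∀ (E : PieceHeap G) {a b : I}, ¬ Concurrent G a b →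
      (E.drop a).restLevel b = E.restLevel b := by
    intro E a b h
    unfold restLevel
    congr 1
    ext p
    simp only [Finset.mem_filter, mem_drop]
    constructor
    · rintro ⟨rfl | hp, hc⟩
      · exact absurd (concurrent_symm hc) h
      · exact ⟨hp, hc⟩
    · rintro ⟨hp, hc⟩
      exact ⟨Or.inr hp, hc⟩
  apply PieceHeap.ext
  ext p
  rw [mem_drop, mem_drop, mem_drop, mem_drop, key E h, key E (fun h' => h (concurrent_symm h'))]
  tauto

theorem foldl_drop_move (c : I) (x : List I) (hx : ∀ b ∈ x, ¬ Concurrent G c b) :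
    ∀ E : PieceHeap G, (x.foldl drop E).drop c = x.foldl drop (E.drop c) := by
  induction x with
  | nil => intro E; rfl
  | cons b x ih =>
    intro E
    rw [List.foldl_cons, List.foldl_cons, ih (fun d hd => hx d (by simp [hd])),
      drop_comm E (hx b (by simp))]

/-- A letter that comes first in all its projections can be moved to the front of a word. -/
theorem exists_split_of_head (c : I) (w : List I)
    (h : ∀ b, Concurrent G c b → (w.filter (fun d => d = c ∨ d = b)).head? = some c) :
    ∃ x y, w = x ++ c :: y ∧ ∀ b ∈ x, ¬ Concurrent G c b := by
  induction w with
  | nil => simpa using h c (concurrent_refl _ _)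
  | cons d w ih =>
    by_cases hd : Concurrent G c d
    · have := h d hd
      have hdc : d = c := by simpa using this
      exact ⟨[], w, by simp [hdc], by simp⟩
    · have hdc : d ≠ c := by
        rintro rfl
        exact hd (concurrent_refl _ _)
      obtain ⟨x, y, rfl, hx⟩ := ih (fun b hb => by
        have := h b hb
        rwa [List.filter_cons_of_neg] at this
        simp only [decide_eq_true_eq]
        rintro (h | h)
        · exact hdc h
        · exact hd (h ▸ hb))
      exact ⟨d :: x, y, rfl, by simpa [hd] using hx⟩

/-- The first letter of `w` comes first in all its projections, hence also in those of `w'`. There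
it commutes to the front and is cancelled. -/
theorem foldl_drop_eq_of_filter_eq (w : List I) : ∀ w' : List I,
    (∀ a b, Concurrent G a b →
      w.filter (fun c => c = a ∨ c = b) = w'.filter (fun c => c = a ∨ c = b)) →
    ∀ E : PieceHeap G, w.foldl drop E = w'.foldl drop E := by
  induction w with
  | nil =>
    intro w' h E
    cases w' with
    | nil => rfl
    | cons c w' => simpa using h c c (concurrent_refl _ _)
  | cons c w ih =>
    intro w' h E
    obtain ⟨x, y, rfl, hx⟩ := exists_split_of_head c w' (G := G) (fun b hb => by
      rw [← h c b hb]
      simp)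
    have hxy := ih (x ++ y) (fun a b hab => by
      have := h a b hab
      rw [List.filter_append, List.filter_cons, List.filter_cons] at this
      rw [List.filter_append]
      split_ifs at this with hc
      -- A letter of `x` surviving the filter would be concurrent to `c`.
      · have hx0 : x.filter (fun c => c = a ∨ c = b) = [] := by
          rw [List.filter_eq_nil_iff]
          intro d hd
          simp only [decide_eq_true_eq] at hc ⊢
          have hxd := hx d hd
          rintro (rfl | rfl) <;> rcases hc with rfl | rfl
          · exact hxd (concurrent_refl _ _)
          · exact hxd (concurrent_symm hab)
          · exact hxd hab
          · exact hxd (concurrent_refl _ _)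
        rw [hx0] at this ⊢
        simpa using this
      · exact this) (E.drop c)
    rw [List.foldl_cons, hxy, List.foldl_append, List.foldl_append, List.foldl_cons,
      ← foldl_drop_move c x hx]

/-! ### The cancellative monoid of heaps -/

theorem ext_proj {E F : PieceHeap G}
    (h : ∀ a b, Concurrent G a b → E.proj a b = F.proj a b) : E = F := by
  rw [← foldl_drop_levelWord E, ← foldl_drop_levelWord F]
  exact foldl_drop_eq_of_filter_eq _ _ h _

theorem proj_superpose (E F : PieceHeap G) {a b : I} (h : Concurrent G a b) :
    (superpose E F).proj a b = E.proj a b ++ F.proj a b :=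
  proj_foldl_drop _ h E

theorem proj_empty (a b : I) : (empty : PieceHeap G).proj a b = [] := by
  simp [proj, levelWord, empty]

theorem levelWord_single (a : I) : (single a : PieceHeap G).levelWord = [a] := by
  simp [levelWord, single]

theorem superpose_single (E : PieceHeap G) (a : I) : superpose E (single a) = E.drop a := by
  rw [superpose, levelWord_single]
  rfl

/-- The axioms, like cancellation below, are inherited from words through the projections. -/
noncomputable instance : Monoid (PieceHeap G) where
  mul := superpose
  one := empty
  mul_assoc E F H := ext_proj fun a b h => by
    show (superpose (superpose E F) H).proj a b = (superpose E (superpose F H)).proj a b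
    simp only [proj_superpose _ _ h, List.append_assoc]
  one_mul E := ext_proj fun a b h => by
    show (superpose empty E).proj a b = _
    simp only [proj_superpose _ _ h, proj_empty, List.nil_append]
  mul_one E := ext_proj fun a b h => by
    show (superpose E empty).proj a b = _
    simp only [proj_superpose _ _ h, proj_empty, List.append_nil]

theorem superpose_eq_mul (E F : PieceHeap G) : superpose E F = E * F := rfl

theorem empty_eq_one : (empty : PieceHeap G) = 1 := rfl

theorem proj_mul (E F : PieceHeap G) {a b : I} (h : Concurrent G a b) :
    (E * F).proj a b = E.proj a b ++ F.proj a b := proj_superpose E F h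

theorem proj_one (a b : I) : (1 : PieceHeap G).proj a b = [] := proj_empty a b

theorem proj_single (c a b : I) :
    (single c : PieceHeap G).proj a b = [c].filter (fun d => d = a ∨ d = b) := by
  rw [proj, levelWord_single]

instance : IsCancelMul (PieceHeap G) where
  mul_left_cancel E F H h := ext_proj fun a b hab => by
    have := congrArg (fun X => proj X a b) h
    simpa only [proj_mul _ _ hab, List.append_cancel_left_eq] using this
  mul_right_cancel E F H h := ext_proj fun a b hab => by
    have := congrArg (fun X => proj X a b) h
    simpa only [proj_mul _ _ hab, List.append_cancel_right_eq] using this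

theorem foldl_drop_eq_mul (w : List I) : ∀ E : PieceHeap G,
    w.foldl drop E = E * (w.map single).prod := by
  induction w with
  | nil => intro E; simp
  | cons a w ih =>
    intro E
    rw [List.foldl_cons, ih, ← superpose_single, superpose_eq_mul, List.map_cons, List.prod_cons,
      mul_assoc]

theorem ofWord_eq_prod (w : List I) : ofWord G w = (w.map single).prod := by
  have : (fun (E : PieceHeap G) a => superpose E (single a)) = drop := by
    funext E a
    exact superpose_single E a
  rw [ofWord, this, foldl_drop_eq_mul, empty_eq_one, one_mul]

theorem prod_levelWord (E : PieceHeap G) : (E.levelWord.map single).prod = E := by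
  conv_rhs => rw [← foldl_drop_levelWord E]
  rw [foldl_drop_eq_mul, empty_eq_one, one_mul]

theorem exists_prod (E : PieceHeap G) : ∃ w : List I, (w.map single).prod = E :=
  ⟨_, prod_levelWord E⟩

theorem proj_prod (w : List I) {a b : I} (h : Concurrent G a b) :
    ((w.map single).prod : PieceHeap G).proj a b = w.filter (fun c => c = a ∨ c = b) := by
  rw [← one_mul ((w.map single).prod : PieceHeap G), ← foldl_drop_eq_mul, proj_foldl_drop w h,
    proj_one, List.nil_append]

theorem weight_eq_length (E : PieceHeap G) (a : I) : E.weight a = (E.proj a a).length := by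
  rw [proj, levelWord_eq_map, List.filter_map, List.length_map, weight,
    ← List.toFinset_card_of_nodup ((E.sortedLT_levelList.imp fun h => h.ne).filter _)]
  refine Finset.card_bij (fun p _ => toLex (p.2, p.1)) ?_ ?_ ?_
  · intro p hp
    rw [Finset.mem_filter] at hp
    rw [List.mem_toFinset, List.mem_filter, mem_levelList]
    exact ⟨hp.1, decide_eq_true (Or.inl hp.2)⟩
  · intro p _ q _ h
    have h' := toLex.injective h
    exact Prod.ext (congrArg Prod.snd h') (congrArg Prod.fst h')
  · intro q hq
    rw [List.mem_toFinset, List.mem_filter, mem_levelList] at hq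
    exact ⟨((ofLex q).2, (ofLex q).1), by simpa using hq, rfl⟩

theorem weight_mul (E F : PieceHeap G) : (E * F).weight = E.weight + F.weight := by
  funext a
  rw [Pi.add_apply, weight_eq_length, weight_eq_length, weight_eq_length,
    proj_mul _ _ (concurrent_refl G a), List.length_append]

theorem weight_one : (1 : PieceHeap G).weight = 0 := by
  funext a
  rw [weight_eq_length, proj_one]
  rfl

theorem weight_single (a b : I) : (single a : PieceHeap G).weight b = if a = b then 1 else 0 := by
  rw [weight_eq_length, proj_single]
  by_cases h : a = b <;> simp [h]

theorem weight_prod (w : List I) (a : I) :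
    ((w.map single).prod : PieceHeap G).weight a = w.count a := by
  induction w with
  | nil => simp [weight_one]
  | cons b w ih =>
    rw [List.map_cons, List.prod_cons, weight_mul, Pi.add_apply, ih, weight_single,
      List.count_cons]
    by_cases h : b = a <;> simp [h, add_comm]

theorem induction_left {P : PieceHeap G → Prop} (one : P 1)
    (mul : ∀ a E, P E → P (single a * E)) (E : PieceHeap G) : P E := by
  obtain ⟨w, rfl⟩ := exists_prod E
  induction w with
  | nil => exact one
  | cons a w ih => exact mul a _ ih

theorem induction_right {P : PieceHeap G → Prop} (one : P 1)
    (mul : ∀ E a, P E → P (E * single a)) (E : PieceHeap G) : P E := by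
  obtain ⟨w, rfl⟩ := exists_prod E
  induction w using List.reverseRecOn with
  | nil => exact one
  | append_singleton w a ih => simpa using mul _ a ih

theorem eq_one_of_weight {E : PieceHeap G} (h : ∀ a, E.weight a = 0) : E = 1 := by
  cases E using induction_left with
  | one => rfl
  | mul a E _ =>
    have := h a
    rw [weight_mul, Pi.add_apply, weight_single, if_pos rfl] at this
    omega

/-! ### Independence and first letters -/

/-- The letter `a` commutes with and does not occur in `E`. -/
def Indep (a : I) (E : PieceHeap G) : Prop :=
  ∀ b, Concurrent G a b → E.weight b = 0

theorem proj_eq_nil {E : PieceHeap G} {a b : I} (ha : E.weight a = 0) (hb : E.weight b = 0) :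
    E.proj a b = [] := by
  have key : ∀ a, E.weight a = 0 → a ∉ E.levelWord := by
    intro a ha
    rw [weight_eq_length, List.length_eq_zero_iff, proj, List.filter_eq_nil_iff] at ha
    intro h
    simpa using ha a h
  rw [proj, List.filter_eq_nil_iff]
  intro c hc
  simp only [decide_eq_true_eq]
  rintro (rfl | rfl)
  · exact key _ ha hc
  · exact key _ hb hc

/-- Heaps without concurrent pieces commute. -/
theorem mul_comm_of_indep {E F : PieceHeap G}
    (h : ∀ a b, Concurrent G a b → E.weight a = 0 ∨ F.weight b = 0) : E * F = F * E := by
  apply ext_proj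
  intro a b hab
  rw [proj_mul _ _ hab, proj_mul _ _ hab]
  have h1 := h a b hab
  have h2 := h b a (concurrent_symm hab)
  have h3 := h a a (concurrent_refl _ _)
  have h4 := h b b (concurrent_refl _ _)
  have : (E.weight a = 0 ∧ E.weight b = 0) ∨ (F.weight a = 0 ∧ F.weight b = 0) := by tauto
  rcases this with ⟨h, h'⟩ | ⟨h, h'⟩ <;> simp [proj_eq_nil h h']

theorem Indep.comm {a : I} {E : PieceHeap G} (h : Indep a E) : single a * E = E * single a :=
  mul_comm_of_indep fun c b hcb => by
    by_cases hc : a = c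
    · subst hc
      exact Or.inr (h b hcb)
    · left
      rw [weight_single, if_neg hc]

/-- The letter `a` is a possible first letter of `E`. -/
def Front (a : I) (E : PieceHeap G) : Prop := ∃ F, E = single a * F

theorem front_iff {a : I} {E : PieceHeap G} :
    Front a E ↔ ∀ b, Concurrent G a b → (E.proj a b).head? = some a := by
  constructor
  · rintro ⟨F, rfl⟩ b hb
    rw [proj_mul _ _ hb, proj_single]
    simp
  · intro h
    obtain ⟨x, y, hxy, hx⟩ := exists_split_of_head (G := G) a E.levelWord h
    refine ⟨(x.map single).prod * (y.map single).prod, ?_⟩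
    have hi : Indep a ((x.map single).prod : PieceHeap G) := fun b hb => by
      rw [weight_prod, List.count_eq_zero]
      exact fun hbx => hx b hbx hb
    rw [← mul_assoc, hi.comm, ← prod_levelWord E, hxy]
    simp [mul_assoc]

theorem Front.weight_pos {a : I} {E : PieceHeap G} (h : Front a E) : 0 < E.weight a := by
  obtain ⟨F, rfl⟩ := h
  rw [weight_mul, Pi.add_apply, weight_single, if_pos rfl]
  omega

theorem Front.mul_right {a : I} {E : PieceHeap G} (h : Front a E) (F : PieceHeap G) :
    Front a (E * F) := by
  obtain ⟨X, rfl⟩ := h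
  exact ⟨X * F, mul_assoc _ _ _⟩

/-- If `a` occurs in `E`, the projections to `a` and `b` begin inside `E`. Otherwise a piece of `E`
concurrent to `a` would precede `a` in a projection. -/
theorem front_mul {a : I} {E F : PieceHeap G} (h : Front a (E * F)) :
    Front a E ∨ (Indep a E ∧ Front a F) := by
  rw [front_iff] at h
  by_cases ha : E.weight a = 0
  · right
    have hi : Indep a E := by
      intro b hb
      by_contra hne
      have h1 := h b hb
      rw [proj_mul _ _ hb] at h1
      have hmem : ∀ c ∈ E.proj a b, c = b := by
        intro c hc
        rw [proj, List.mem_filter] at hc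
        rcases of_decide_eq_true hc.2 with rfl | h
        · exfalso
          rw [weight_eq_length, List.length_eq_zero_iff, proj, List.filter_eq_nil_iff] at ha
          exact ha c hc.1 (by simp)
        · exact h
      cases hp : E.proj a b with
      | nil =>
        apply hne
        rw [weight_eq_length, List.length_eq_zero_iff]
        rw [proj, List.filter_eq_nil_iff] at hp ⊢
        intro c hc hcb
        exact hp c hc (by simp at hcb ⊢; exact Or.inr hcb)
      | cons d l =>
        rw [hp] at h1 hmem
        have hd : d = a := by simpa using h1
        have hdb : d = b := hmem d (by simp)
        exact hne (by rw [← hdb, hd]; exact ha)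
    refine ⟨hi, front_iff.2 fun b hb => ?_⟩
    have h1 := h b hb
    rwa [proj_mul _ _ hb, proj_eq_nil ha (hi b hb), List.nil_append] at h1
  · left
    refine front_iff.2 fun b hb => ?_
    have h1 := h b hb
    rw [proj_mul _ _ hb, List.head?_append_of_ne_nil] at h1
    · exact h1
    · intro hp
      apply ha
      rw [weight_eq_length, List.length_eq_zero_iff]
      rw [proj, List.filter_eq_nil_iff] at hp ⊢
      intro c hc hcb
      exact hp c hc (by simp at hcb ⊢; exact Or.inl hcb)

theorem exists_front {E : PieceHeap G} (h : E ≠ 1) : ∃ a, Front a E := by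
  cases E using induction_left with
  | one => exact absurd rfl h
  | mul a E _ => exact ⟨a, E, rfl⟩

theorem front_iff_level_zero {a : I} {E : PieceHeap G} : Front a E ↔ (a, 0) ∈ E.pieces := by
  constructor
  · rintro ⟨F, rfl⟩
    induction F using induction_right with
    | one => simp [single]
    | mul F b ih =>
      rw [← mul_assoc, ← superpose_eq_mul _ (single b), superpose_single, mem_drop]
      exact Or.inr ih
  · intro h
    have hm : toLex (0, a) ∈ E.levelList := mem_levelList.2 h
    obtain ⟨x, y, hxy⟩ := List.append_of_mem hm
    have hs := E.sortedLT_levelList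
    rw [hxy, List.pairwise_append] at hs
    -- Pieces listed before `(a, 0)` are on level 0 too, so none is concurrent to it.
    have hi : Indep a ((x.map (fun q => single (ofLex q).2)).prod : PieceHeap G) := by
      intro b hb
      have := weight_prod (G := G) (x.map (fun q : ℕ ×ₗ I => (ofLex q).2)) b
      rw [List.map_map] at this
      refine this.trans ?_
      rw [List.count_eq_zero, List.mem_map]
      rintro ⟨q, hq, rfl⟩
      have hlt := hs.2.2 q hq _ List.mem_cons_self
      have hqE : q ∈ E.levelList := by rw [hxy]; simp [hq]
      have hne := E.preheap _ h _ (mem_levelList.1 hqE) (by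
        intro he
        apply hlt.ne
        apply ofLex.injective
        exact Prod.ext (congrArg Prod.snd he).symm (congrArg Prod.fst he).symm) hb
      rw [Prod.Lex.lt_iff] at hlt
      rcases hlt with h' | h'
      · exact absurd h' (Nat.not_lt_zero _)
      · exact hne h'.1.symm
    refine ⟨(x.map (fun q => single (ofLex q).2)).prod *
      (y.map (fun q => single (ofLex q).2)).prod, ?_⟩
    rw [← mul_assoc, hi.comm]
    conv_lhs => rw [← prod_levelWord E, levelWord_eq_map, List.map_map, hxy]
    simp [mul_assoc, Function.comp_def]

end Words

/-! ### Pyramids and their free factorization into blocks -/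

section Based

variable {I : Type*} [LinearOrder I] {G : SimpleGraph I}

/-- `E` is empty or a pyramid with basis `j`. -/
def Based (j : I) (E : PieceHeap G) : Prop := ∀ a, Front a E → a = j

theorem based_one (j : I) : Based j (1 : PieceHeap G) := fun a h => by
  have := h.weight_pos
  rw [weight_one] at this
  exact absurd this (lt_irrefl _)

theorem Based.mul {j : I} {E F : PieceHeap G} (hE : Based j E) (hF : Based j F) :
    Based j (E * F) := fun a h => by
  rcases front_mul h with h | h
  · exact hE a h
  · exact hF a h.2

theorem Based.left {j : I} {E F : PieceHeap G} (h : Based j (E * F)) : Based j E :=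
  fun a ha => h a (ha.mul_right F)

theorem based_single (j : I) : Based j (single j : PieceHeap G) := fun a h => by
  have := h.weight_pos
  rw [weight_single] at this
  split_ifs at this with h
  · exact h.symm
  · exact absurd this (lt_irrefl _)

theorem Based.front {j : I} {E : PieceHeap G} (h : Based j E) (hE : E ≠ 1) : Front j E := by
  obtain ⟨a, ha⟩ := exists_front hE
  exact h a ha ▸ ha

theorem Based.eq_one {j : I} {E : PieceHeap G} (h : Based j E) (hE : E.weight j = 0) : E = 1 := by
  by_contra hne
  exact (h.front hne).weight_pos.ne' hE

theorem mul_eq_one_left {E F : PieceHeap G} (h : E * F = 1) : E = 1 :=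
  eq_one_of_weight fun a => by
    have := congrFun (congrArg weight h) a
    rw [weight_mul, weight_one, Pi.add_apply, Pi.zero_apply] at this
    omega

theorem mul_eq_one_right {E F : PieceHeap G} (h : E * F = 1) : F = 1 := by
  have hE := mul_eq_one_left h
  rwa [hE, one_mul] at h

/-- Every piece above level 0 has a support, so the minimal pieces are those on level 0, that is,
the first letters. -/
theorem isPyramid_iff {j : I} {E : PieceHeap G} : E.IsPyramid j ↔ E ≠ 1 ∧ Based j E := by
  have hmin : ∀ p, p ∈ E.minPieces ↔ p ∈ E.pieces ∧ p.2 = 0 := by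
    rintro ⟨a, i⟩
    constructor
    · rintro ⟨hp, h⟩
      refine ⟨hp, ?_⟩
      cases i with
      | zero => rfl
      | succ i =>
        obtain ⟨b, hb, hc⟩ := E.supported a i hp
        have := h _ hb (Relation.ReflTransGen.single
          ⟨hb, hp, concurrent_symm hc, Nat.lt_succ_self i⟩)
        simp at this
    · rintro ⟨hp, h⟩
      refine ⟨hp, fun q _ hqp => ?_⟩
      rcases Relation.ReflTransGen.cases_tail hqp with h' | ⟨r, -, hr⟩
      · exact h'.symm
      · exact absurd hr.2.2.2 (by simp only at h; simp [h])
  constructor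
  · rintro ⟨i, hi⟩
    have hj : (j, i) ∈ E.pieces ∧ i = 0 := (hmin (j, i)).1 (by rw [hi]; rfl)
    constructor
    · rintro rfl
      exact absurd hj.1 (by simp [← empty_eq_one, empty])
    · intro a ha
      rw [front_iff_level_zero] at ha
      have := (hmin (a, 0)).2 ⟨ha, rfl⟩
      rw [hi] at this
      exact congrArg Prod.fst this
  · rintro ⟨hne, hE⟩
    refine ⟨0, ?_⟩
    ext ⟨a, i⟩
    rw [hmin, Set.mem_singleton_iff]
    constructor
    · rintro ⟨hp, rfl : i = 0⟩
      rw [hE a (front_iff_level_zero.2 hp)]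
    · intro h
      obtain ⟨rfl, rfl⟩ := Prod.mk.inj h
      exact ⟨front_iff_level_zero.1 (hE.front hne), rfl⟩

/-- A new top letter that is independent of `P` slides down into `U`, unless it is `j`, in which
case `P` is empty and the letter starts it. A letter that is not independent of `P` creates no new
first letter. -/
theorem exists_decomp (j : I) (X : PieceHeap G) :
    ∃ U P, X = U * P ∧ U.weight j = 0 ∧ Based j P := by
  induction X using induction_right with
  | one => exact ⟨1, 1, (one_mul 1).symm, by simp [weight_one], based_one j⟩
  | mul X b ih =>
    obtain ⟨U, P, rfl, hU, hP⟩ := ih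
    by_cases hi : Indep b P
    · by_cases hb : b = j
      · subst hb
        have hP1 : P = 1 := hP.eq_one (hi b (concurrent_refl G b))
        exact ⟨U, single b, by rw [hP1, mul_one], hU, based_single b⟩
      · refine ⟨U * single b, P, by rw [mul_assoc, mul_assoc, hi.comm], ?_, hP⟩
        rw [weight_mul, Pi.add_apply, hU, weight_single, if_neg hb]
    · refine ⟨U, P * single b, mul_assoc _ _ _, hU, fun a ha => ?_⟩
      rcases front_mul ha with h | ⟨h, h'⟩
      · exact hP a h
      · obtain rfl := based_single b a h'
        exact absurd h hi

/-- The first letter of `U` is not `j`, so it cannot come from `P'` and is cancelled from `U'`. -/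
theorem decomp_unique {j : I} {U U' P P' : PieceHeap G} (hU : U.weight j = 0)
    (hU' : U'.weight j = 0) (hP : Based j P) (hP' : Based j P') (h : U * P = U' * P') :
    U = U' ∧ P = P' := by
  induction U using induction_left generalizing U' with
  | one =>
    rw [one_mul] at h
    by_cases hU1 : U' = 1
    · subst hU1
      exact ⟨rfl, by simpa using h⟩
    · obtain ⟨a, ha⟩ := exists_front hU1
      have haj : a = j := hP a (h ▸ ha.mul_right P')
      exact absurd (haj ▸ ha).weight_pos hU'.not_gt
  | mul a Y ih =>
    rw [weight_mul, Pi.add_apply, weight_single] at hU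
    have haj : a ≠ j := fun h => by simp [h] at hU
    have hY : Y.weight j = 0 := by omega
    have hf : Front a (U' * P') := ⟨Y * P, by rw [← h, mul_assoc]⟩
    rcases front_mul hf with ⟨Y', rfl⟩ | hf
    · rw [mul_assoc, mul_assoc, mul_left_cancel_iff] at h
      rw [weight_mul, Pi.add_apply] at hU'
      obtain ⟨rfl, rfl⟩ := ih (U' := Y') hY (by omega) h
      exact ⟨rfl, rfl⟩
    · exact absurd (hP' a hf.2) haj

/-- A pyramid with basis `j` without further pieces in position `j`. -/
def Block (j : I) (E : PieceHeap G) : Prop := Based j E ∧ E.weight j = 1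

theorem block_single (j : I) : Block j (single j : PieceHeap G) :=
  ⟨based_single j, by simp [weight_single]⟩

theorem Block.ne_one {j : I} {E : PieceHeap G} (h : Block j E) : E ≠ 1 := by
  rintro rfl
  have := h.2
  simp [weight_one] at this

/-- Past the first `j`, split off the maximal pyramid part. What precedes it is the block. -/
theorem exists_block_mul {j : I} {E : PieceHeap G} (hE : Based j E) (h : E ≠ 1) :
    ∃ A X, Block j A ∧ Based j X ∧ E = A * X := by
  obtain ⟨Y, rfl⟩ := hE.front h
  obtain ⟨U, P, rfl, hU, hP⟩ := exists_decomp j Y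
  rw [← mul_assoc] at hE
  refine ⟨single j * U, P, ⟨hE.left, ?_⟩, hP, (mul_assoc _ _ _).symm⟩
  rw [weight_mul, Pi.add_apply, weight_single, if_pos rfl, hU]

theorem block_mul_unique {j : I} {A A' X X' : PieceHeap G} (hA : Block j A) (hA' : Block j A')
    (hX : Based j X) (hX' : Based j X') (h : A * X = A' * X') : A = A' ∧ X = X' := by
  obtain ⟨U, rfl⟩ := hA.1.front hA.ne_one
  obtain ⟨U', rfl⟩ := hA'.1.front hA'.ne_one
  have h1 := hA.2
  have h2 := hA'.2
  rw [weight_mul, Pi.add_apply, weight_single, if_pos rfl] at h1 h2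
  rw [mul_assoc, mul_assoc, mul_left_cancel_iff] at h
  obtain ⟨rfl, rfl⟩ := decomp_unique (by omega) (by omega) hX hX' h
  exact ⟨rfl, rfl⟩

/-- If `E * Z = Z * F` with `E` and `F` pyramids with basis `j`, then `Z` is a product of a heap
without concurrent pieces to `E` and a heap that is empty or a pyramid with basis `j`. -/
theorem exists_strip {j : I} {E F Z : PieceHeap G} (hE : Based j E)
    (h : E * Z = Z * F) : ∃ U P, Z = U * P ∧ Based j P ∧ E * P = P * F ∧
      ∀ a b, Concurrent G a b → U.weight a = 0 ∨ E.weight b = 0 := by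
  obtain ⟨U, P, rfl, hU, hP⟩ := exists_decomp j Z
  suffices E * P = P * F ∧ ∀ a b, Concurrent G a b → U.weight a = 0 ∨ E.weight b = 0 from
    ⟨U, P, rfl, hP, this⟩
  induction U using induction_left with
  | one =>
    rw [one_mul] at h
    exact ⟨h, fun a b _ => Or.inl (by simp [weight_one])⟩
  | mul a Y ih =>
    rw [weight_mul, Pi.add_apply, weight_single] at hU
    have haj : a ≠ j := fun h => by simp [h] at hU
    -- As `a ≠ j` is no first letter of `E`, it must be independent of `E`, and so cancels from both
    -- sides.
    have hf : Front a (E * (single a * Y * P)) := ⟨Y * P * F, by rw [h]; simp only [mul_assoc]⟩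
    rcases front_mul hf with hf | ⟨hi, -⟩
    · exact absurd (hE a hf) haj
    · have h' : E * (Y * P) = Y * P * F := by
        apply mul_left_cancel (a := single a)
        rw [← mul_assoc, hi.comm]
        simpa only [mul_assoc] using h
      obtain ⟨h1, h2⟩ := ih h' (by omega)
      refine ⟨h1, fun c b hcb => ?_⟩
      rw [weight_mul, Pi.add_apply, weight_single]
      by_cases hac : a = c
      · subst hac
        exact Or.inr (hi b hcb)
      · simpa [hac] using h2 c b hcb

end Based

/-! ### Pyramids as periodic sequences of blocks -/

open Function

section Sequences

variable {I : Type*} [LinearOrder I] {G : SimpleGraph I}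

/-- The shift of a sequence. -/
def shift {α : Type*} (f : ℕ → α) (i : ℕ) : α := f (i + 1)

theorem shift_iterate {α : Type*} (f : ℕ → α) (n : ℕ) : shift^[n] f = fun i => f (i + n) := by
  induction n with
  | zero => rfl
  | succ n ih =>
    rw [iterate_succ_apply', ih]
    funext i
    show f (i + 1 + n) = f (i + (n + 1))
    congr 1
    omega

/-- The product of the first `n` terms of a sequence of heaps. -/
noncomputable def partialProd (f : ℕ → PieceHeap G) : ℕ → PieceHeap G
  | 0 => 1
  | n + 1 => partialProd f n * f n

theorem partialProd_add (f : ℕ → PieceHeap G) (a b : ℕ) :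
    partialProd f (a + b) = partialProd f a * partialProd (shift^[a] f) b := by
  induction b with
  | zero => exact (mul_one _).symm
  | succ b ih =>
    rw [← add_assoc, partialProd, partialProd, ih, mul_assoc, shift_iterate, add_comm a b]

theorem partialProd_one (f : ℕ → PieceHeap G) : partialProd f 1 = f 0 := one_mul _

theorem partialProd_succ' (f : ℕ → PieceHeap G) (n : ℕ) :
    partialProd f (n + 1) = f 0 * partialProd (shift f) n := by
  rw [add_comm, partialProd_add, partialProd_one]
  rfl

theorem partialProd_congr {f g : ℕ → PieceHeap G} {n : ℕ} (h : ∀ i < n, f i = g i) :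
    partialProd f n = partialProd g n := by
  induction n with
  | zero => rfl
  | succ n ih => rw [partialProd, partialProd, ih fun i hi => h i (by omega), h n (by omega)]

theorem partialProd_mul {f : ℕ → PieceHeap G} {r : ℕ} (h : IsPeriodicPt shift r f) (n : ℕ) :
    partialProd f (r * n) = partialProd f r ^ n := by
  induction n with
  | zero => rfl
  | succ n ih =>
    rw [Nat.mul_succ, partialProd_add, ih, pow_succ, (h.mul_const n).eq]

variable {j : I}

theorem based_partialProd {f : ℕ → PieceHeap G} (hf : ∀ i, Block j (f i)) (n : ℕ) :
    Based j (partialProd f n) := by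
  induction n with
  | zero => exact based_one j
  | succ n ih => exact ih.mul (hf n).1

theorem weight_partialProd {f : ℕ → PieceHeap G} (hf : ∀ i, Block j (f i)) (n : ℕ) :
    (partialProd f n).weight j = n := by
  induction n with
  | zero => rw [partialProd, weight_one]; rfl
  | succ n ih => rw [partialProd, weight_mul, Pi.add_apply, ih, (hf n).2]

theorem weight_pow (E : PieceHeap G) (n : ℕ) (a : I) : (E ^ n).weight a = n * E.weight a := by
  induction n with
  | zero => simp [weight_one]
  | succ n ih => rw [pow_succ, weight_mul, Pi.add_apply, ih, Nat.succ_mul]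

theorem block_shift {f : ℕ → PieceHeap G} (hf : ∀ i, Block j (f i)) (n : ℕ) :
    ∀ i, Block j (shift^[n] f i) := fun i => by
  rw [shift_iterate]
  exact hf _

theorem exists_sequence {E : PieceHeap G} (hE : Based j E) :
    ∃ f : ℕ → PieceHeap G, (∀ i, Block j (f i)) ∧ partialProd f (E.weight j) = E := by
  obtain ⟨n, hn⟩ : ∃ n, E.weight j = n := ⟨_, rfl⟩
  induction n generalizing E with
  | zero =>
    rw [hE.eq_one hn]
    -- The tail is irrelevant; `single j` only keeps every term a block.
    exact ⟨fun _ => single j, fun _ => block_single j, by rw [weight_one]; rfl⟩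
  | succ n ih =>
    obtain ⟨A, X, hA, hX, rfl⟩ := exists_block_mul hE (by
      rintro rfl
      rw [weight_one] at hn
      exact absurd hn (Nat.succ_ne_zero n).symm)
    have hX' : X.weight j = n := by
      rw [weight_mul, Pi.add_apply, hA.2] at hn
      omega
    obtain ⟨f, hf, hfX⟩ := ih hX hX'
    refine ⟨fun i => Nat.casesOn i A f, fun i => by cases i <;> simp [hA, hf], ?_⟩
    rw [hn, partialProd_succ', ← hX']
    exact congrArg (A * ·) hfX

theorem exists_periodic {E : PieceHeap G} (hE : Based j E) :
    ∃ f : ℕ → PieceHeap G, (∀ i, Block j (f i)) ∧ IsPeriodicPt shift (E.weight j) f ∧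
      partialProd f (E.weight j) = E := by
  obtain ⟨f, hf, hfE⟩ := exists_sequence hE
  -- For weight 0 this is `f` itself, since `i % 0 = i`, and period 0 is no condition.
  refine ⟨fun i => f (i % E.weight j), fun i => hf _, ?_, ?_⟩
  · show shift^[_] _ = _
    rw [shift_iterate]
    funext i
    simp
  · conv_rhs => rw [← hfE]
    exact partialProd_congr fun i hi => by rw [Nat.mod_eq_of_lt hi]

theorem partialProd_unique {f g : ℕ → PieceHeap G} (hf : ∀ i, Block j (f i))
    (hg : ∀ i, Block j (g i)) {X Y : PieceHeap G} (hX : Based j X) (hY : Based j Y) {n : ℕ}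
    (h : partialProd f n * X = partialProd g n * Y) : (∀ i < n, f i = g i) ∧ X = Y := by
  induction n generalizing f g with
  | zero => exact ⟨fun i hi => absurd hi (Nat.not_lt_zero i), by simpa [partialProd] using h⟩
  | succ n ih =>
    rw [partialProd_succ', partialProd_succ', mul_assoc, mul_assoc] at h
    have hf' := block_shift hf 1
    have hg' := block_shift hg 1
    obtain ⟨h0, h1⟩ := block_mul_unique (hf 0) (hg 0)
      ((based_partialProd hf' n).mul hX) ((based_partialProd hg' n).mul hY) h
    obtain ⟨h2, h3⟩ := ih hf' hg' h1
    refine ⟨fun i hi => ?_, h3⟩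
    cases i with
    | zero => exact h0
    | succ i => exact h2 i (by omega)

theorem eq_of_isPeriodicPt {α : Type*} {f g : ℕ → α} {r : ℕ} (hr : 0 < r)
    (hf : IsPeriodicPt shift r f) (hg : IsPeriodicPt shift r g) (h : ∀ i < r, f i = g i) :
    f = g := by
  have key : ∀ f : ℕ → α, IsPeriodicPt shift r f → ∀ i, f i = f (i % r) := by
    intro f hf i
    have h1 := congrFun (hf.mul_const (i / r)).eq (i % r)
    rw [shift_iterate] at h1
    rw [← h1]
    simp only [Nat.mod_add_div]
  funext i
  rw [key f hf, key g hg, h _ (Nat.mod_lt i hr)]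

theorem eq_of_partialProd_eq {f g : ℕ → PieceHeap G} (hf : ∀ i, Block j (f i))
    (hg : ∀ i, Block j (g i)) {r : ℕ} (hr : 0 < r) (hfr : IsPeriodicPt shift r f)
    (hgr : IsPeriodicPt shift r g) (h : partialProd f r = partialProd g r) : f = g :=
  eq_of_isPeriodicPt hr hfr hgr
    (partialProd_unique hf hg (based_one j) (based_one j) (by rw [h])).1

theorem isPeriodicPt_shift_iterate {α : Type*} {f : ℕ → α} {r : ℕ} (h : IsPeriodicPt shift r f)
    (s : ℕ) : IsPeriodicPt shift r (shift^[s] f) :=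
  h.apply_iterate s

/-- Pyramids that are conjugate through a pyramid are rotations of each other. -/
theorem eq_shift_of_mul_eq {f g : ℕ → PieceHeap G} (hf : ∀ i, Block j (f i))
    (hg : ∀ i, Block j (g i)) {r : ℕ} (hr : 0 < r) (hfr : IsPeriodicPt shift r f)
    (hgr : IsPeriodicPt shift r g) {Z : PieceHeap G} (hZ : Based j Z)
    (h : partialProd f r * Z = Z * partialProd g r) :
    Z = partialProd f (Z.weight j) ∧ g = shift^[Z.weight j] f := by
  obtain ⟨z, hz, hzZ⟩ := exists_sequence hZ
  set s := Z.weight j with hs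
  -- Powers make the left factor long enough: with `n = s` it has at least `s` blocks, and its first
  -- `s` blocks must spell `Z`.
  have hn : ∀ n, partialProd f (r * n) * Z = Z * partialProd g (r * n) := by
    intro n
    rw [partialProd_mul hfr, partialProd_mul hgr]
    exact SemiconjBy.pow_right (a := Z) (x := partialProd g r) (y := partialProd f r) h.symm n
      |>.symm
  obtain ⟨t, ht⟩ : ∃ t, r * s = s + t := Nat.exists_eq_add_of_le (Nat.le_mul_of_pos_left s hr)
  have h1 := hn s
  have hgs := based_partialProd hg (r * s)
  have hZf : Z = partialProd f s := by
    rw [ht, partialProd_add f, mul_assoc, ← ht] at h1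
    conv_rhs at h1 => rw [← hzZ]
    rw [← hzZ]
    exact (partialProd_congr (partialProd_unique hf hz
      ((based_partialProd (block_shift hf s) t).mul hZ) hgs h1).1).symm
  refine ⟨hZf, ?_⟩
  -- Splitting these `r + s` blocks after the first `s` and cancelling `Z` leaves `g` as the shift.
  have h2 : partialProd f r * Z = partialProd f (r + s) := by
    rw [partialProd_add, hfr.eq, ← hZf]
  rw [h, add_comm, partialProd_add, ← hZf, mul_left_cancel_iff] at h2
  exact eq_of_partialProd_eq hg (block_shift hf s) hr hgr (isPeriodicPt_shift_iterate hfr s) h2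

end Sequences

/-! ### Conjugacy, powers and connectedness -/

section Conjugacy

variable {I : Type*} [LinearOrder I] {G : SimpleGraph I}

theorem conjugate_mul_comm (U V : PieceHeap G) : Conjugate (U * V) (V * U) :=
  Relation.TransGen.single ⟨U, V, rfl, rfl⟩

theorem Conjugate.refl (E : PieceHeap G) : Conjugate E E := by
  have := conjugate_mul_comm E 1
  rwa [mul_one, one_mul] at this

theorem Conjugate.trans {E F H : PieceHeap G} (h : Conjugate E F) (h' : Conjugate F H) :
    Conjugate E H :=
  Relation.TransGen.trans h h'

theorem Conjugate.induction {P : PieceHeap G → Prop} (hP : ∀ U V, P (U * V) → P (V * U))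
    {E F : PieceHeap G} (h : Conjugate E F) (hE : P E) : P F := by
  induction h with
  | single h =>
    obtain ⟨U, V, rfl, rfl⟩ := h
    exact hP U V hE
  | tail _ h ih =>
    obtain ⟨U, V, rfl, rfl⟩ := h
    exact hP U V ih

theorem Conjugate.symm {E F : PieceHeap G} (h : Conjugate E F) : Conjugate F E :=
  h.induction (P := fun F => Conjugate F E)
    (fun U V hUV => (conjugate_mul_comm V U).trans hUV) (Conjugate.refl E)

theorem Conjugate.weight_eq {E F : PieceHeap G} (h : Conjugate E F) : F.weight = E.weight :=
  h.induction (P := fun F => F.weight = E.weight)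
    (fun U V hUV => by rw [← hUV, weight_mul, weight_mul, add_comm]) rfl

theorem Conjugate.exists_mul_eq {E F : PieceHeap G} (h : Conjugate E F) :
    ∃ Z, E * Z = Z * F :=
  h.induction (P := fun F => ∃ Z, E * Z = Z * F)
    (fun U V ⟨Z, hZ⟩ => ⟨Z * U, by rw [← mul_assoc, hZ]; simp only [mul_assoc]⟩)
    ⟨1, by rw [mul_one, one_mul]⟩

/-- A first letter `a` of `D ^ n` is already one of `D = a * D'`, and moving it to the end turns `D
^ n` into `(D' * a) ^ n`. Transpositions are done letter by letter. -/
theorem Conjugate.exists_pow {C F : PieceHeap G} {n : ℕ} (h : Conjugate (C ^ n) F) :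
    ∃ D, F = D ^ n := by
  have key : ∀ a (X : PieceHeap G), (∃ D, single a * X = D ^ n) → ∃ D, X * single a = D ^ n := by
    rintro a X ⟨D, hD⟩
    have hf : Front a D := by
      have h1 : Front a (D ^ n) := ⟨X, hD.symm⟩
      clear hD h
      induction n with
      | zero =>
        rw [pow_zero] at h1
        have := h1.weight_pos
        rw [weight_one] at this
        exact absurd this (lt_irrefl _)
      | succ n ih =>
        rw [pow_succ'] at h1
        rcases front_mul h1 with h1 | h1
        · exact h1
        · have := (ih h1.2).weight_pos
          exact absurd (h1.1 a (concurrent_refl G a)) this.ne'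
    obtain ⟨D', rfl⟩ := hf
    refine ⟨D' * single a, ?_⟩
    apply mul_left_cancel (a := single a)
    rw [← mul_assoc, hD]
    exact (SemiconjBy.pow_right (a := single a) (x := D' * single a) (y := single a * D')
      (by simp [SemiconjBy, mul_assoc]) n).symm
  refine h.induction (P := fun F => ∃ D, F = D ^ n) (fun U => ?_) ⟨C, rfl⟩
  induction U using induction_left with
  | one => intro V h; simpa using h
  | mul a U ih =>
    intro V h
    rw [mul_assoc] at h
    have := ih _ (by simpa only [mul_assoc] using key a _ h)
    simpa only [mul_assoc] using this

theorem isPrimitive_iff {E : PieceHeap G} :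
    E.IsPrimitive ↔ ∀ U V, E = U * V → E = V * U → U = 1 ∨ V = 1 := Iff.rfl

/-- A primitive heap is connected. -/
theorem IsPrimitive.eq_one_or_eq_one {E U V : PieceHeap G} (hE : E.IsPrimitive)
    (hw : E.weight = (U * V).weight)
    (hUV : ∀ a b, Concurrent G a b → U.weight a = 0 ∨ V.weight b = 0) : U = 1 ∨ V = 1 := by
  classical
  set w := E.levelWord with hwd
  have hEw : E = (w.map single).prod := (prod_levelWord E).symm
  -- `X` and `Y` are the parts of `E` over the supports of `U` and `V`. No position of one is
  -- concurrent to a position of the other, so they commute with product `E`.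
  set X : PieceHeap G := ((w.filter (fun a => U.weight a ≠ 0)).map single).prod with hX
  set Y : PieceHeap G := ((w.filter (fun a => ¬ U.weight a ≠ 0)).map single).prod with hY
  have hcount : ∀ a, E.weight a = w.count a := fun a => by rw [hEw, weight_prod]
  have hwa : ∀ a, E.weight a = U.weight a + V.weight a := fun a => by
    rw [hw, weight_mul, Pi.add_apply]
  have hXw : ∀ a, X.weight a = U.weight a := by
    intro a
    rw [hX, weight_prod]
    by_cases h : U.weight a = 0
    · rw [h, List.count_eq_zero, List.mem_filter]
      simp [h]
    · rw [List.count_filter (by simpa using h), ← hcount, hwa,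
        (hUV a a (concurrent_refl G a)).resolve_left h, add_zero]
  have hYw : ∀ a, Y.weight a = V.weight a := by
    intro a
    rw [hY, weight_prod]
    by_cases h : U.weight a = 0
    · rw [List.count_filter (by simpa using h), ← hcount, hwa, h, zero_add]
    · rw [(hUV a a (concurrent_refl G a)).resolve_left h, List.count_eq_zero, List.mem_filter]
      simp [h]
  have hcomm : X * Y = Y * X := mul_comm_of_indep fun a b hab => by
    rw [hXw, hYw]
    exact hUV a b hab
  have hXY : E = X * Y := by
    apply ext_proj
    intro a b hab
    rw [proj_mul _ _ hab]
    by_cases h : U.weight a = 0 ∧ U.weight b = 0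
    · rw [proj_eq_nil ((hXw a).trans h.1) ((hXw b).trans h.2), List.nil_append, hEw,
        proj_prod _ hab, proj_prod _ hab, List.filter_filter]
      refine List.filter_congr fun c _ => ?_
      by_cases hc : c = a ∨ c = b
      · rcases hc with rfl | rfl <;> simp [h.1, h.2]
      · simp [hc]
    · have hV : V.weight a = 0 ∧ V.weight b = 0 := by
        have h1 := hUV a b hab
        have h2 := hUV b a (concurrent_symm hab)
        have h3 := hUV a a (concurrent_refl G a)
        have h4 := hUV b b (concurrent_refl G b)
        tauto
      rw [proj_eq_nil ((hYw a).trans hV.1) ((hYw b).trans hV.2), List.append_nil, hEw,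
        proj_prod _ hab, proj_prod _ hab, List.filter_filter]
      refine List.filter_congr fun c hc => ?_
      have hc' : E.weight c ≠ 0 := by
        rw [hcount]
        exact (List.count_pos_iff.2 hc).ne'
      by_cases hcab : c = a ∨ c = b
      · have hUc : U.weight c ≠ 0 := by
          rw [hwa] at hc'
          rcases hcab with rfl | rfl <;> omega
        simp [hUc]
      · simp [hcab]
  rcases hE X Y hXY (hXY.trans hcomm) with h | h
  · left
    apply eq_one_of_weight
    intro a
    rw [← hXw, h, empty_eq_one, weight_one]
    rfl
  · right
    apply eq_one_of_weight
    intro a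
    rw [← hYw, h, empty_eq_one, weight_one]
    rfl

end Conjugacy

/-! ### Primitive heaps and minimal periods -/

section Primitive

variable {I : Type*} [LinearOrder I] {G : SimpleGraph I}

/-- The sequences of blocks that represent the primitive pyramids of weight `m` with basis `j`. -/
def primitiveSeqs (G : SimpleGraph I) (j : I) (m : I → ℕ) : Set (ℕ → PieceHeap G) :=
  {f | (∀ i, Block j (f i)) ∧ minimalPeriod shift f = m j ∧ (partialProd f (m j)).weight = m}

variable {j : I} {m : I → ℕ} {f g : ℕ → PieceHeap G}

theorem isPeriodicPt_of_mem (hf : f ∈ primitiveSeqs G j m) : IsPeriodicPt shift (m j) f :=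
  hf.2.1 ▸ isPeriodicPt_minimalPeriod shift f

theorem shift_mem (hm : 0 < m j) (hf : f ∈ primitiveSeqs G j m) :
    shift f ∈ primitiveSeqs G j m ∧
      Conjugate (partialProd f (m j)) (partialProd (shift f) (m j)) := by
  have hper := isPeriodicPt_of_mem hf
  have hc : Conjugate (partialProd f (m j)) (partialProd (shift f) (m j)) := by
    have h1 := hper.eq
    obtain ⟨r, hr⟩ := Nat.exists_eq_succ_of_ne_zero hm.ne'
    rw [hr, shift_iterate] at h1
    rw [hr, Nat.succ_eq_add_one, partialProd_succ', partialProd]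
    have h2 : shift f r = f 0 := by
      have := congrFun h1 0
      simpa [shift] using this
    rw [h2]
    exact conjugate_mul_comm _ _
  refine ⟨⟨fun i => hf.1 _, ?_, ?_⟩, hc⟩
  · rw [minimalPeriod_apply ⟨m j, hm, hper⟩, hf.2.1]
  · rw [hc.weight_eq, hf.2.2]

theorem shift_iterate_mem (hm : 0 < m j) (hf : f ∈ primitiveSeqs G j m) (s : ℕ) :
    shift^[s] f ∈ primitiveSeqs G j m ∧
      Conjugate (partialProd f (m j)) (partialProd (shift^[s] f) (m j)) := by
  induction s with
  | zero => exact ⟨hf, Conjugate.refl _⟩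
  | succ s ih =>
    have := shift_mem hm ih.1
    rw [iterate_succ_apply']
    exact ⟨this.1, ih.2.trans this.2⟩

theorem exists_shift_of_conjugate (hm : 0 < m j) (hf : f ∈ primitiveSeqs G j m)
    (hg : g ∈ primitiveSeqs G j m)
    (h : Conjugate (partialProd f (m j)) (partialProd g (m j))) :
    ∃ s < m j, shift^[s] f = g := by
  obtain ⟨Z, hZ⟩ := h.exists_mul_eq
  obtain ⟨U, P, -, hP, hPZ, -⟩ := exists_strip (based_partialProd hf.1 (m j)) hZ
  have := (eq_shift_of_mul_eq hf.1 hg.1 hm (isPeriodicPt_of_mem hf) (isPeriodicPt_of_mem hg)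
    hP hPZ).2
  refine ⟨P.weight j % m j, Nat.mod_lt _ hm, ?_⟩
  rw [this, (isPeriodicPt_of_mem hf).iterate_mod_apply]

/-- Once stripped of a factor with no piece in the support of `m`, `Q` is a prefix of `f` fixing `f`
as a shift, so it consists of whole periods. -/
theorem weight_of_commute (hm : 0 < m j) (hf : f ∈ primitiveSeqs G j m) {Q : PieceHeap G}
    (h : partialProd f (m j) * Q = Q * partialProd f (m j)) :
    ∃ c, ∀ b, 0 < m b → Q.weight b = c * m b := by
  obtain ⟨U, P, rfl, hP, hPE, hU⟩ := exists_strip (based_partialProd hf.1 (m j)) h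
  have hper := isPeriodicPt_of_mem hf
  obtain ⟨h1, h2⟩ := eq_shift_of_mul_eq hf.1 hf.1 hm hper hper hP hPE
  have h3 : minimalPeriod shift f ∣ P.weight j := IsPeriodicPt.minimalPeriod_dvd h2.symm
  rw [hf.2.1] at h3
  obtain ⟨c, hc⟩ := h3
  refine ⟨c, fun b hb => ?_⟩
  have hUb := (hU b b (concurrent_refl G b)).resolve_right (by rw [hf.2.2]; exact hb.ne')
  rw [weight_mul, Pi.add_apply, hUb, zero_add, h1, hc, partialProd_mul hper, weight_pow, hf.2.2]

/-- With `Z` and `W` conjugating to `T` and back, `Z * W` and `Z * X * W` both commute with the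
pyramid; their weights differ by that of `X`. -/
theorem weight_of_commute_conjugate (hm : 0 < m j) (hf : f ∈ primitiveSeqs G j m)
    {T X : PieceHeap G} (h : Conjugate (partialProd f (m j)) T) (hX : X * T = T * X) :
    ∃ c d, ∀ b, 0 < m b → c * m b + X.weight b = d * m b := by
  obtain ⟨Z, hZ⟩ := h.exists_mul_eq
  obtain ⟨W, hW⟩ := h.symm.exists_mul_eq
  obtain ⟨c, hc⟩ := weight_of_commute hm hf (Q := Z * W) (by
    rw [← mul_assoc, hZ, mul_assoc, hW, mul_assoc])
  obtain ⟨d, hd⟩ := weight_of_commute hm hf (Q := Z * X * W) (by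
    rw [← mul_assoc, ← mul_assoc, hZ, mul_assoc Z T X, ← hX, mul_assoc Z, mul_assoc X, hW]
    simp only [mul_assoc])
  refine ⟨c, d, fun b hb => ?_⟩
  rw [← hc b hb, ← hd b hb]
  simp only [weight_mul, Pi.add_apply]
  omega

/-- The heaps conjugate to a primitive pyramid are primitive. -/
theorem isPrimitive_of_conjugate (hm : 0 < m j) (hf : f ∈ primitiveSeqs G j m) {T : PieceHeap G}
    (h : Conjugate (partialProd f (m j)) T) : T.IsPrimitive := by
  rw [isPrimitive_iff]
  have hcomm : ∀ X Y : PieceHeap G, T = X * Y → T = Y * X → X * T = T * X := by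
    intro X Y h1 h2
    conv_lhs => rw [h2]
    rw [h1, mul_assoc]
  have hT : ∀ X Y : PieceHeap G, T = X * Y → ∀ b, X.weight b + Y.weight b = m b := by
    intro X Y h1 b
    rw [← hf.2.2, ← h.weight_eq, h1, weight_mul, Pi.add_apply]
  have key : ∀ X Y : PieceHeap G, T = X * Y → T = Y * X → X.weight j = 0 → X = 1 := by
    intro X Y h1 h2 hX
    obtain ⟨c, d, hcd⟩ := weight_of_commute_conjugate hm hf h (hcomm X Y h1 h2)
    have h3 := hcd j hm
    rw [hX, add_zero] at h3
    -- Without pieces in position `j`, the multiple of `m` in `X` is zero.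
    obtain rfl := Nat.eq_of_mul_eq_mul_right hm h3
    apply eq_one_of_weight
    intro b
    have h5 := hT X Y h1 b
    by_cases hb : 0 < m b
    · have h4 := hcd b hb
      omega
    · omega
  intro X Y h1 h2
  by_cases hX : X.weight j = 0
  · exact Or.inl (key X Y h1 h2 hX)
  · right
    apply key Y X h2 h1
    obtain ⟨c, d, hcd⟩ := weight_of_commute_conjugate hm hf h (hcomm X Y h1 h2)
    have h6 := hcd j hm
    -- So `X` takes all pieces in position `j`, and `key` applies to `Y`.
    have h7 : m j ∣ X.weight j := by
      rw [← Nat.dvd_add_right (Dvd.intro_left c rfl), h6]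
      exact Dvd.intro_left d rfl
    have h8 := Nat.le_of_dvd (Nat.pos_of_ne_zero hX) h7
    have h9 := hT X Y h1 j
    omega

/-- A primitive heap with a piece in position `j` is conjugate to a pyramid with basis `j`. -/
theorem exists_based_conjugate {L : PieceHeap G} (hL : L.IsPrimitive) (hj : 0 < L.weight j) :
    ∃ V, Based j V ∧ Conjugate L V := by
  classical
  -- Among the conjugates of the form `u` followed by a pyramid `V`, one with `u` shortest is taken.
  have hex : ∃ n, ∃ u : List I, ∃ V : PieceHeap G, u.length = n ∧ Based j V ∧ 0 < V.weight j ∧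
      Conjugate L ((u.map single).prod * V) := by
    obtain ⟨U, V, hUV, hU, hV⟩ := exists_decomp j L
    obtain ⟨u, rfl⟩ := exists_prod U
    refine ⟨_, u, V, rfl, hV, ?_, hUV ▸ Conjugate.refl L⟩
    rw [hUV, weight_mul, Pi.add_apply] at hj
    omega
  obtain ⟨u, V, hu, hV, hVj, hc⟩ := Nat.find_spec hex
  have hmin := fun n (hn : n < Nat.find hex) => Nat.find_min hex hn
  -- Rotate `u` letter by letter. A rotated letter not independent of `V` would join the pyramid and
  -- shorten `u`, so all of `u` is independent of `V`, and connectedness makes it empty.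
  have key : ∀ x y : List I, u = x ++ y →
      Conjugate L (((y ++ x).map single).prod * V) ∧ ∀ a ∈ x, Indep a V := by
    intro x
    induction x using List.reverseRecOn with
    | nil =>
      intro y hy
      rw [List.nil_append] at hy
      subst hy
      exact ⟨by simpa using hc, by simp⟩
    | append_singleton x a ih =>
      intro y hy
      obtain ⟨h1, h2⟩ := ih (a :: y) (by rw [hy]; simp)
      have h3 : Conjugate L (((y ++ x).map single).prod * (V * single a)) := by
        refine h1.trans ?_
        have := conjugate_mul_comm (single a) (((y ++ x).map single).prod * V : PieceHeap G)
        simpa [mul_assoc] using this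
      have ha : Indep a V := by
        by_contra hi
        refine hmin (y ++ x).length ?_ ⟨y ++ x, V * single a, rfl, ?_, ?_, h3⟩
        · rw [← hu, hy]
          simp only [List.length_append, List.length_singleton]
          omega
        · intro b hb
          rcases front_mul hb with h | ⟨h, h'⟩
          · exact hV b h
          · obtain rfl := based_single a b h'
            exact absurd h hi
        · rw [weight_mul, Pi.add_apply]
          omega
      refine ⟨?_, ?_⟩
      · rw [← ha.comm] at h3
        simpa [mul_assoc] using h3
      · intro b hb
        rw [List.mem_append, List.mem_singleton] at hb
        rcases hb with hb | rfl
        · exact h2 b hb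
        · exact ha
  have hind := (key u [] (by simp)).2
  rcases hL.eq_one_or_eq_one hc.weight_eq.symm (fun a b hab => by
    rw [weight_prod]
    by_cases ha : a ∈ u
    · exact Or.inr (hind a ha b hab)
    · exact Or.inl (List.count_eq_zero.2 ha)) with h | h
  · rw [h, one_mul] at hc
    exact ⟨V, hV, hc⟩
  · rw [h, weight_one] at hVj
    exact absurd hVj (lt_irrefl _)

/-- A smaller period would make the pyramid, and with it `L`, a proper power `D ^ (n + 2)`, which
splits into the commuting factors `D` and `D ^ (n + 1)`. -/
theorem exists_primitiveSeq {L : PieceHeap G} (hL : L.IsPrimitive) (hj : 0 < L.weight j) :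
    ∃ f ∈ primitiveSeqs G j L.weight, Conjugate L (partialProd f (L.weight j)) := by
  obtain ⟨V, hV, hc⟩ := exists_based_conjugate hL hj
  obtain ⟨f, hf, hper, hfV⟩ := exists_periodic hV
  rw [hc.weight_eq] at hper hfV
  rw [← hfV] at hc
  refine ⟨f, ⟨hf, ?_, hc.weight_eq⟩, hc⟩
  obtain ⟨n, hn⟩ := hper.minimalPeriod_dvd
  rw [hn, partialProd_mul (isPeriodicPt_minimalPeriod shift f)] at hc
  obtain ⟨D, hD⟩ := hc.symm.exists_pow
  rcases n with _ | _ | n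
  · omega
  · rw [hn, zero_add, mul_one]
  · exfalso
    have h0 : D = 1 ∨ D ^ (n + 1) = 1 :=
      isPrimitive_iff.1 hL D (D ^ (n + 1)) (by rw [hD, pow_succ']) (by rw [hD, pow_succ])
    have h1 : D = 1 := by
      rcases h0 with h | h
      · exact h
      · rw [pow_succ] at h
        exact mul_eq_one_right h
    rw [hD, h1, one_pow, weight_one] at hj
    exact absurd hj (lt_irrefl _)

/-- The sequences of blocks with period `k j` that represent the pyramids of weight `k`. -/
def periodicSeqs (G : SimpleGraph I) (j : I) (k : I → ℕ) : Set (ℕ → PieceHeap G) :=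
  {f | (∀ i, Block j (f i)) ∧ IsPeriodicPt shift (k j) f ∧ (partialProd f (k j)).weight = k}

theorem bijOn_periodicSeqs {j : I} {k : I → ℕ} (hk : 0 < k j) :
    Set.BijOn (fun f => partialProd f (k j)) (periodicSeqs G j k) (pyramids G k j) := by
  refine ⟨?_, ?_, ?_⟩
  · rintro f ⟨hf, -, hw⟩
    refine ⟨isPyramid_iff.2 ⟨fun h => ?_, based_partialProd hf _⟩, hw⟩
    have := weight_partialProd hf (k j)
    rw [show partialProd f (k j) = 1 from h, weight_one] at this
    exact hk.ne this
  · rintro f ⟨hf, hfp, -⟩ g ⟨hg, hgp, -⟩ h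
    exact eq_of_partialProd_eq hf hg hk hfp hgp h
  · rintro E ⟨hE, rfl⟩
    obtain ⟨f, hf, hfp, hfE⟩ := exists_periodic (isPyramid_iff.1 hE).2
    exact ⟨f, ⟨hf, hfp, by rw [hfE]⟩, hfE⟩

end Primitive

/-! ### Uniqueness of the Lyndon heap in a class -/

section Lyndon

variable {I : Type*} [LinearOrder I] {G : SimpleGraph I}

theorem heapLE_antisymm {E F : PieceHeap G} (h : heapLE E F) (h' : heapLE F E) : E = F := by
  obtain ⟨u, v, hu, hv, huv⟩ := h
  obtain ⟨v', u', hv', hu', hvu⟩ := h'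
  have h1 : u' = u := le_antisymm (hu.2 hu'.1) (hu'.2 hu.1)
  have h2 : v' = v := le_antisymm (hv.2 hv'.1) (hv'.2 hv.1)
  subst h1 h2
  have h3 : u' = v' := le_antisymm huv hvu
  rw [← hu.1, ← hv.1, h3]

theorem IsLyndon.eq_of_conjugate {E F : PieceHeap G} (hE : E.IsLyndon) (hF : F.IsLyndon)
    (h : Conjugate E F) : E = F :=
  heapLE_antisymm (hE.2.2 F h) (hF.2.2 E h.symm)

end Lyndon

/-! ### Finiteness and counting -/

section Finiteness

variable {I : Type*} [Fintype I] [LinearOrder I] {G : SimpleGraph I}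

theorem length_eq_sum (w : List I) :
    w.length = ∑ a, ((w.map single).prod : PieceHeap G).weight a := by
  simp only [weight_prod]
  rw [← List.sum_toFinset_count_eq_length]
  exact Finset.sum_subset (Finset.subset_univ _) fun a _ ha => by
    rw [List.mem_toFinset] at ha
    exact List.count_eq_zero.2 ha

theorem finite_weight (m : I → ℕ) : {E : PieceHeap G | E.weight = m}.Finite := by
  refine ((List.finite_length_eq I (∑ a, m a)).image fun w => (w.map single).prod).subset ?_
  rintro E rfl
  obtain ⟨w, rfl⟩ := exists_prod E
  exact ⟨w, length_eq_sum w, rfl⟩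

theorem exists_isStandardWord (E : PieceHeap G) : ∃ w, E.IsStandardWord w := by
  have hfin : {v : List I | ofWord G v = E}.Finite := by
    refine (List.finite_length_eq I (∑ a, E.weight a)).subset ?_
    rintro v rfl
    show v.length = _
    rw [ofWord_eq_prod]
    exact length_eq_sum v
  obtain ⟨w, hw, hmax⟩ := Set.exists_max_image _ id hfin
    ⟨E.levelWord, (ofWord_eq_prod _).trans (prod_levelWord E)⟩
  exact ⟨w, hw, fun v hv => hmax v hv⟩

theorem exists_isLyndon {E : PieceHeap G} (hne : E ≠ 1)
    (hE : ∀ F, Conjugate E F → F.IsPrimitive) : ∃ L, L.IsLyndon ∧ Conjugate E L := by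
  choose st hst using exists_isStandardWord (G := G)
  obtain ⟨L, hL, hmin⟩ := Set.exists_min_image {F | Conjugate E F} st
    ((finite_weight E.weight).subset fun F hF => hF.weight_eq) ⟨E, Conjugate.refl E⟩
  refine ⟨L, ⟨?_, hE L hL, fun F hF => ⟨_, _, hst L, hst F, hmin F (hL.trans hF)⟩⟩, hL⟩
  rintro rfl
  apply hne
  apply eq_one_of_weight
  intro a
  rw [← hL.weight_eq, empty_eq_one, weight_one]
  rfl

/-- Each Lyndon heap gets a representing sequence `rep`. Its `m j` shifts are distinct by minimality
of the period, and exhaust the sequences in its conjugacy class. -/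
theorem ncard_primitiveSeqs {j : I} {m : I → ℕ} (hm : 0 < m j) :
    (primitiveSeqs G j m).ncard = m j * (lyndonHeaps G m).ncard := by
  have hex : ∀ L ∈ lyndonHeaps G m, ∃ f ∈ primitiveSeqs G j m,
      Conjugate L (partialProd f (m j)) := by
    rintro L ⟨hL, rfl⟩
    exact exists_primitiveSeq hL.2.1 hm
  choose! rep hrep hconj using hex
  have hbij : Set.BijOn (fun p : ℕ × PieceHeap G => shift^[p.1] (rep p.2))
      (Set.Iio (m j) ×ˢ lyndonHeaps G m) (primitiveSeqs G j m) := by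
    refine ⟨?_, ?_, ?_⟩
    · rintro ⟨s, L⟩ ⟨-, hL⟩
      exact (shift_iterate_mem hm (hrep L hL) s).1
    · rintro ⟨s, L⟩ ⟨hs, hL⟩ ⟨s', L'⟩ ⟨hs', hL'⟩ h
      simp only at h hs hs' hL hL'
      have h1 := (hconj L hL).trans (shift_iterate_mem hm (hrep L hL) s).2
      rw [h] at h1
      have h2 := h1.trans ((hconj L' hL').trans (shift_iterate_mem hm (hrep L' hL') s').2).symm
      obtain rfl := hL.1.eq_of_conjugate hL'.1 h2
      have h3 := (hrep L hL).2.1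
      rw [iterate_eq_iterate_iff_of_lt_minimalPeriod (h3 ▸ hs) (h3 ▸ hs')] at h
      rw [h]
    · intro f hf
      have hne : partialProd f (m j) ≠ 1 := fun h => by
        have := hf.2.2
        rw [h, weight_one] at this
        rw [← this] at hm
        exact absurd hm (lt_irrefl _)
      obtain ⟨L, hL, hfL⟩ := exists_isLyndon hne fun F hF => isPrimitive_of_conjugate hm hf hF
      have hLm : L ∈ lyndonHeaps G m := ⟨hL, hfL.weight_eq.trans hf.2.2⟩
      obtain ⟨s, hs, hsf⟩ := exists_shift_of_conjugate hm (hrep L hLm) hf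
        (hfL.trans (hconj L hLm)).symm
      exact ⟨(s, L), ⟨hs, hLm⟩, hsf⟩
  rw [← hbij.image_eq, hbij.injOn.ncard_image, Set.ncard_prod, ← Finset.coe_Iio,
    Set.ncard_coe_finset, Nat.card_Iio]

/-- If the minimal period is `k j / l`, the pyramid is an `l`-th power, so `l` divides the whole
weight and not just `k j`. -/
theorem periodicSeqs_eq {j : I} {k : I → ℕ} (hk : 0 < k j) :
    periodicSeqs G j k =
      ⋃ l ∈ weightDivisors k, primitiveSeqs G j (fun i => k i / l) := by
  have hk0 : k ≠ 0 := fun h => by simp [h] at hk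
  ext f
  simp only [Set.mem_iUnion, exists_prop]
  constructor
  · rintro ⟨hf, hfp, hw⟩
    obtain ⟨l, hl⟩ := hfp.minimalPeriod_dvd
    have hper := isPeriodicPt_minimalPeriod shift f
    have hl0 : 0 < l := by
      rcases Nat.eq_zero_or_pos l with rfl | h
      · omega
      · exact h
    have hki : ∀ i, k i = l * (partialProd f (minimalPeriod shift f)).weight i := fun i => by
      rw [hl, partialProd_mul hper] at hw
      rw [← weight_pow, hw]
    have hdiv : k j / l = minimalPeriod shift f := by rw [hl, Nat.mul_div_cancel _ hl0]
    refine ⟨l, (mem_weightDivisors hk0 l).2 ⟨hl0, fun i => ⟨_, hki i⟩⟩, hf, hdiv.symm, ?_⟩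
    funext i
    show (partialProd f (k j / l)).weight i = k i / l
    rw [hdiv, hki i, Nat.mul_div_cancel_left _ hl0]
  · rintro ⟨l, hl, hf, hmin, hw⟩
    obtain ⟨hl0, hdvd⟩ := (mem_weightDivisors hk0 l).1 hl
    simp only at hmin hw
    have hper := isPeriodicPt_minimalPeriod shift f
    rw [hmin] at hper
    refine ⟨hf, ?_, ?_⟩
    · rw [← Nat.div_mul_cancel (hdvd j)]
      exact hper.mul_const l
    · funext i
      rw [← Nat.div_mul_cancel (hdvd j), partialProd_mul hper, weight_pow, hw,
        Nat.mul_div_cancel' (hdvd i)]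

theorem finite_pyramids (k : I → ℕ) (j : I) : (pyramids G k j).Finite :=
  (finite_weight k).subset fun _ h => h.2

theorem ncard_pyramids (k : I → ℕ) (j : I) :
    (pyramids G k j).ncard =
      ∑ l ∈ weightDivisors k, k j / l * (lyndonHeaps G (fun i => k i / l)).ncard := by
  rcases Nat.eq_zero_or_pos (k j) with hk | hk
  · have : pyramids G k j = ∅ := by
      ext E
      simp only [Set.mem_empty_iff_false, iff_false]
      rintro ⟨hE, rfl⟩
      rw [isPyramid_iff] at hE
      exact hE.1 (hE.2.eq_one hk)
    simp [this, hk]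
  · have hk0 : k ≠ 0 := fun h => by simp [h] at hk
    have hbij := bijOn_periodicSeqs (G := G) hk
    have hfin : (periodicSeqs G j k).Finite := by
      apply Set.Finite.of_finite_image _ hbij.injOn
      rw [hbij.image_eq]
      exact finite_pyramids k j
    rw [← hbij.image_eq, hbij.injOn.ncard_image, periodicSeqs_eq hk]
    have hpos : ∀ l ∈ weightDivisors k, 0 < k j / l := fun l hl => by
      obtain ⟨hl0, hdvd⟩ := (mem_weightDivisors hk0 l).1 hl
      exact Nat.div_pos (Nat.le_of_dvd hk (hdvd j)) hl0
    have hdisj : (weightDivisors k : Set ℕ).PairwiseDisjoint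
        (fun l => primitiveSeqs G j (fun i => k i / l)) := by
      intro l hl l' hl' hne
      refine Set.disjoint_left.2 fun f hf hf' => hne ?_
      -- Both quotients are the minimal period of `f`, which determines `l` as `k j` is positive.
      have h1 : k j / l = k j / l' := hf.2.1.symm.trans hf'.2.1
      have h2 := Nat.div_mul_cancel (((mem_weightDivisors hk0 l).1 hl).2 j)
      have h3 := Nat.div_mul_cancel (((mem_weightDivisors hk0 l').1 hl').2 j)
      rw [← h1] at h3
      exact Nat.eq_of_mul_eq_mul_left (hpos l hl) (h2.trans h3.symm)
    have hsub : ∀ l ∈ weightDivisors k,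
        (primitiveSeqs G j (fun i => k i / l)).Finite := fun l hl =>
      hfin.subset (by
        rw [periodicSeqs_eq hk]
        exact Set.subset_biUnion_of_mem (u := fun l => primitiveSeqs G j (fun i => k i / l)) hl)
    rw [← Finset.set_biUnion_coe, Set.Finite.ncard_biUnion (Finset.finite_toSet _) hsub hdisj,
      finsum_mem_coe_finset]
    exact Finset.sum_congr rfl fun l hl => ncard_primitiveSeqs (hpos l hl)

end Finiteness

end PieceHeap

theorem mainTheorem4 {I : Type*} [Fintype I] [LinearOrder I] (G : SimpleGraph I)
    (k : I → ℕ) (j : I) :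
    (PieceHeap.pyramids G k j).Finite ∧
    (∀ m : I → ℕ, (PieceHeap.lyndonHeaps G m).Finite) ∧
    ((PieceHeap.pyramids G k j).ncard : ℚ) =
      ∑ l ∈ weightDivisors k,
        ((k j : ℚ) / (l : ℚ)) * ((PieceHeap.lyndonHeaps G (fun i => k i / l)).ncard : ℚ) := by
  refine ⟨PieceHeap.finite_pyramids k j,
    fun m => (PieceHeap.finite_weight m).subset fun _ h => h.2, ?_⟩
  rw [PieceHeap.ncard_pyramids, Nat.cast_sum]
  refine Finset.sum_congr rfl fun l hl => ?_
  -- For `k = 0` the gcd is 0, and `Nat.divisors 0` is empty, so no `l` occurs.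
  have hk : k ≠ 0 := by
    rintro rfl
    rw [weightDivisors, (Finset.gcd_eq_zero_iff (s := Finset.univ) (f := (0 : I → ℕ))).2
      fun _ _ => rfl] at hl
    simp at hl
  obtain ⟨hl0, hdvd⟩ := (mem_weightDivisors hk l).1 hl
  rw [Nat.cast_mul, Nat.cast_div (hdvd j) (Nat.cast_ne_zero.2 hl0.ne')]
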